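/- Let $F$ be a field and let $\{\Gamma_i\}_{i\in\mathbb N}$ be a sequence of finite simplicial graphs (undirected, without loops or multiple edges). For each $i$ let $$A(\Gamma_i)=\langle V(\Gamma_i)\mid [v,w]=1 \text{ for } \{v,w\}\in E(\Gamma_i)\rangle$$ be the right-angled Artin group of $\Gamma_i$, and let $$V_i=H^1(A(\Gamma_i),F),\qquad W_i=H^2(A(\Gamma_i),F),\qquad q_i\colon V_i\times V_i\to W_i$$ be its first and second cohomology with trivial coefficients together with the cup product pairing. *Graphs.* A graph is connected if any two of its vertices are joined by a path. For a finite graph $\Gamma$ and $\emptyset\ne A\subset V(\Gamma)$ let $\partial A$ be the set of vertices outside $A$ that are adjacent to a vertex of $A$. The Cheeger constant of $\Gamma$ is the infimum of $|\partial A|/|A|$ over all nonempty $A\subset V(\Gamma)$ with $|A|\le |V(\Gamma)|/2$ (and $+\infty$ if there is no such $A$). The sequence $\{\Gamma_i\}$ is an expander family if every $\Gamma_i$ is connected, there is a $d$ such that all vertices of all $\Gamma_i$ have degree at most $d$, $|V(\Gamma_i)|\to\infty$, and there is an $\epsilon>0$ such that the Cheeger constant of $\Gamma_i$ is at least $\epsilon$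 for all $i$. *Pairings.* Let $q\colon V\times V\to W$ be a bilinear pairing of finite dimensional $F$-vector spaces. The triple $(V,W,q)$ is pairing-connected if for every decomposition $V=V_0\oplus V_1$ with $V_0,V_1\neq 0$ there are $v_0\in V_0$, $v_1\in V_1$ with $q(v_0,v_1)\ne 0$. The $q$-valence of $V$ is $$d(V)=\min_{S}\ \min_{B}\ \max_{s\in S}\ |\{b\in B\mid q(s,b)\neq 0\}|,$$ where $S$ ranges over the nonempty spanning subsets of $V$ and $B$ over the bases of $V$. The Cheeger constant $c_V$ is the infimum of $$c_Z=\frac{\dim V-\dim Z-\dim C+\dim(C\cap Z)}{\dim Z},\qquad C=\{v\in V\mid q(v,z)=0\text{ for all }z\in Z\},$$ over all subspaces $0\ne Z\subset V$ with $\dim Z\le(\dim V)/2$ (and $+\infty$ if there is no such $Z$). **Theorem.** The sequence $\{\Gamma_i\}_{i\in\mathbb N}$ is an expander family if and only if 1. for each $i$, the triple $(V_i,W_i,q_i)$ is pairing-connected; 2. there is a $d$ such that for all $i$ the $q_i$-valence of $V_i$ is at most $d$; 3. $\dim V_i\to\infty$; 4. there is an $\epsilon>0$ such that $c_{V_i}\ge\epsilon$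 for all $i$. Moreover, for each $i$, the Cheeger constant $c_{V_i}$ is equal to the Cheeger constant of $\Gamma_i$. -/

import Mathlib

universe u

/-! ### Graphs: vertex boundary, Cheeger constant, expander families -/

section Graphs

variable {V : Type*}

/-- The vertex boundary `∂A`: the vertices outside `A` that are adjacent to a vertex of `A`. -/
def SimpleGraph.vertexBoundary (Γ : SimpleGraph V) (A : Set V) : Set V :=
  {w | w ∉ A ∧ ∃ a ∈ A, Γ.Adj a w}

/-- The isoperimetric constant `|∂A| / |A|` of a (nonempty) set of vertices. -/
noncomputable def SimpleGraph.isoperimetricConst (Γ : SimpleGraph V) (A : Set V) : ℝ :=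
  ((Γ.vertexBoundary A).ncard : ℝ) / (A.ncard : ℝ)

/-- The Cheeger constant of a finite graph: the infimum of `|∂A| / |A|` over the nonempty sets `A`
of at most half of the vertices. It takes values in the extended reals, so that it is `+∞` when
there is no such set (a graph with at most one vertex). -/
noncomputable def SimpleGraph.cheegerConst (Γ : SimpleGraph V) : EReal :=
  ⨅ A ∈ {A : Set V | A.Nonempty ∧ 2 * A.ncard ≤ Nat.card V},
    ((Γ.isoperimetricConst A : ℝ) : EReal)

/-- A sequence of finite graphs is an expander family if every graph is connected (any two vertices
are joined by a path), the degrees are uniformly bounded, the number of vertices tends to infinity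
and the Cheeger constants are uniformly bounded away from zero. -/
structure IsGraphExpanderFamily {V : ℕ → Type*} (Γ : ∀ i, SimpleGraph (V i)) : Prop where
  connected : ∀ i, (Γ i).Preconnected
  degree_bounded : ∃ d : ℕ, ∀ i, ∀ v : V i, ((Γ i).neighborSet v).ncard ≤ d
  card_tendsto : Filter.Tendsto (fun i => Nat.card (V i)) Filter.atTop Filter.atTop
  cheeger_bounded : ∃ ε : ℝ, 0 < ε ∧ ∀ i, (ε : EReal) ≤ (Γ i).cheegerConst

end Graphs

/-! ### Vector spaces with a vector-space valued bilinear pairing -/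

namespace Pairing

section

variable {F V W : Type*} [Field F] [AddCommGroup V] [Module F V] [AddCommGroup W] [Module F W]

/-- `(V, W, q)` is pairing-connected if for every decomposition `V = V₀ ⊕ V₁` into nonzero
subspaces, `q` does not vanish identically on `V₀ × V₁`. -/
def IsConnected (q : V →ₗ[F] V →ₗ[F] W) : Prop :=
  ∀ V₀ V₁ : Submodule F V, IsCompl V₀ V₁ → V₀ ≠ ⊥ → V₁ ≠ ⊥ →
    ∃ v₀ ∈ V₀, ∃ v₁ ∈ V₁, q v₀ v₁ ≠ 0

/-- The set `B` of vectors is a basis of `V`. -/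
def IsBasisSet (F : Type*) {V : Type*} [Field F] [AddCommGroup V] [Module F V] (B : Set V) : Prop :=
  LinearIndepOn F id B ∧ Submodule.span F B = ⊤

/-- `d_B(S)`: the largest number, over `s ∈ S`, of elements `b` of `B` with `q(s, b) ≠ 0`. -/
noncomputable def valenceWrt (q : V →ₗ[F] V →ₗ[F] W) (B S : Set V) : ℕ∞ :=
  ⨆ s ∈ S, {b ∈ B | q s b ≠ 0}.encard

/-- `d(S)`: the minimum of `d_B(S)` over all bases `B` of `V`. -/
noncomputable def valenceOf (q : V →ₗ[F] V →ₗ[F] W) (S : Set V) : ℕ∞ :=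
  ⨅ B ∈ {B : Set V | IsBasisSet F B}, valenceWrt q B S

/-- The `q`-valence `d(V)`: the minimum of `d(S)` over all nonempty `S` that span `V`. -/
noncomputable def valence (q : V →ₗ[F] V →ₗ[F] W) : ℕ∞ :=
  ⨅ S ∈ {S : Set V | S.Nonempty ∧ Submodule.span F S = ⊤}, valenceOf q S

/-- The orthogonal complement of `Z`: all `v` with `q(v, z) = 0` for every `z ∈ Z`. -/
def orthogonal (q : V →ₗ[F] V →ₗ[F] W) (Z : Submodule F V) : Submodule F V where
  carrier := {v | ∀ z ∈ Z, q v z = 0}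
  zero_mem' := fun z _ => by simp
  add_mem' := fun {a b} ha hb z hz => by simp [ha z hz, hb z hz]
  smul_mem' := fun c a ha z hz => by simp [ha z hz]

/-- The isoperimetric constant
`c_Z = (dim V - dim Z - dim C + dim (C ∩ Z)) / dim Z`, where `C` is the orthogonal complement
of `Z` (and `V` is finite dimensional, `Z ≠ 0`). -/
noncomputable def isoperimetricConst (q : V →ₗ[F] V →ₗ[F] W) (Z : Submodule F V) : ℝ :=
  ((Module.finrank F V : ℝ) - (Module.finrank F Z : ℝ) - (Module.finrank F (orthogonal q Z) : ℝ)
      + (Module.finrank F (orthogonal q Z ⊓ Z : Submodule F V) : ℝ)) / (Module.finrank F Z : ℝ)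

/-- The Cheeger constant `c_V` of `(V, W, q)`: the infimum of `c_Z` over the nonzero subspaces `Z`
of dimension at most half of that of `V` (it is `+∞` when there is no such subspace, that is,
when `dim V ≤ 1`). -/
noncomputable def cheegerConst (q : V →ₗ[F] V →ₗ[F] W) : EReal :=
  ⨅ Z ∈ {Z : Submodule F V | Z ≠ ⊥ ∧ 2 * Module.finrank F Z ≤ Module.finrank F V},
    ((isoperimetricConst q Z : ℝ) : EReal)

end

/-- A sequence of (finite dimensional) triples `(V i, W i, q i)` is a family of vector space
expanders. -/
structure IsExpanderFamily {F : Type*} [Field F] {V W : ℕ → Type*}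
    [∀ i, AddCommGroup (V i)] [∀ i, Module F (V i)]
    [∀ i, AddCommGroup (W i)] [∀ i, Module F (W i)]
    (q : ∀ i, V i →ₗ[F] V i →ₗ[F] W i) : Prop where
  connected : ∀ i, IsConnected (q i)
  valence_bounded : ∃ d : ℕ, ∀ i, valence (q i) ≤ (d : ℕ∞)
  dim_tendsto : Filter.Tendsto (fun i => Module.finrank F (V i)) Filter.atTop Filter.atTop
  cheeger_bounded : ∃ ε : ℝ, 0 < ε ∧ ∀ i, (ε : EReal) ≤ cheegerConst (q i)

end Pairing

/-! ### Cup product in degree one of group cohomology with trivial coefficients -/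

namespace CupProduct

variable (F G : Type u) [Field F] [Group G]

/-- `H¹(G, F)`, for the trivial action of `G` on `F`. -/
abbrev H1 : Type u := groupCohomology.H1 (Rep.trivial F G F)

/-- `H²(G, F)`, for the trivial action of `G` on `F`. -/
abbrev H2 : Type u := groupCohomology.H2 (Rep.trivial F G F)

variable {F G}

/-- The cup product of two `1`-cocycles: the `2`-cocycle `(g, h) ↦ f₁(g) * f₂(h)`. -/
def cocycle (f₁ f₂ : groupCohomology.cocycles₁ (Rep.trivial F G F)) :
    groupCohomology.cocycles₂ (Rep.trivial F G F) :=
  ⟨fun p => (f₁ p.1 * f₂ p.2 : F), by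
    rw [groupCohomology.mem_cocycles₂_iff]
    intro g h j
    rw [groupCohomology.cocycles₁_map_mul_of_isTrivial f₁,
      groupCohomology.cocycles₁_map_mul_of_isTrivial f₂]
    change ((f₁ g + f₁ h : F) * f₂ j + f₁ g * f₂ h : F)
      = f₁ h * f₂ j + f₁ g * (f₂ h + f₂ j : F)
    ring⟩

/-- The `1`-cocycle that represents a class in `H¹(G, F)` (it is unique, as the action on `F` is
trivial). -/
noncomputable def repr :
    H1 F G →ₗ[F] groupCohomology.cocycles₁ (Rep.trivial F G F) :=
  (groupCohomology.cocycles₁IsoOfIsTrivial (Rep.trivial F G F)).inv.hom ∘ₗ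
    (groupCohomology.H1IsoOfIsTrivial (Rep.trivial F G F)).hom.hom

theorem repr_H1π (f : groupCohomology.cocycles₁ (Rep.trivial F G F)) :
    repr (groupCohomology.H1π (Rep.trivial F G F) f) = f := by
  ext g
  exact groupCohomology.H1IsoOfIsTrivial_H1π_apply_apply f (Additive.ofMul g)

/-- The cup product `H¹(G, F) × H¹(G, F) → H²(G, F)`. -/
noncomputable def cup : H1 F G →ₗ[F] H1 F G →ₗ[F] H2 F G :=
  LinearMap.mk₂ F
    (fun a b => groupCohomology.H2π (Rep.trivial F G F) (cocycle (repr a) (repr b)))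
    (fun a a' b => by
      rw [← map_add]; congr 1; ext g h; rw [map_add]
      exact add_mul (repr a g : F) (repr a' g) (repr b h))
    (fun c a b => by
      rw [← map_smul]; congr 1; ext g h; rw [map_smul]
      exact mul_assoc (c : F) (repr a g) (repr b h))
    (fun a b b' => by
      rw [← map_add]; congr 1; ext g h; rw [map_add]
      exact mul_add (repr a g : F) (repr b h) (repr b' h))
    (fun c a b => by
      rw [← map_smul]; congr 1; ext g h; rw [map_smul]
      exact mul_left_comm (repr a g : F) c (repr b h))

/-- On classes of cocycles the cup product is the class of the cup product of the cocycles. -/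
theorem cup_H1π (f₁ f₂ : groupCohomology.cocycles₁ (Rep.trivial F G F)) :
    cup (groupCohomology.H1π (Rep.trivial F G F) f₁) (groupCohomology.H1π (Rep.trivial F G F) f₂)
      = groupCohomology.H2π (Rep.trivial F G F) (cocycle f₁ f₂) := by
  have h : ∀ f : groupCohomology.cocycles₁ (Rep.trivial F G F),
      repr (groupCohomology.H1π (Rep.trivial F G F) f) = f := repr_H1π
  change groupCohomology.H2π (Rep.trivial F G F) (cocycle (repr _) (repr _)) = _
  exact congrArg _ (congrArg₂ cocycle (h f₁) (h f₂))

end CupProduct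

/-! ### Right-angled Artin groups and their cohomology triples -/

/-- The right-angled Artin group `A(Γ)`: generated by the vertices, with the relations that adjacent
vertices commute. -/
abbrev RightAngledArtinGroup {V : Type*} (Γ : SimpleGraph V) : Type _ :=
  PresentedGroup {r : FreeGroup V | ∃ v w, Γ.Adj v w ∧
    r = FreeGroup.of v * FreeGroup.of w * (FreeGroup.of v)⁻¹ * (FreeGroup.of w)⁻¹}

/-- The pairing of the cohomology triple `(H¹(A(Γ), F), H²(A(Γ), F), ∪)` of a graph. -/
noncomputable def SimpleGraph.cohomologyPairing {V : Type u} (Γ : SimpleGraph V)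
    (F : Type u) [Field F] :
    CupProduct.H1 F (RightAngledArtinGroup Γ) →ₗ[F] CupProduct.H1 F (RightAngledArtinGroup Γ) →ₗ[F]
      CupProduct.H2 F (RightAngledArtinGroup Γ) :=
  CupProduct.cup

/-!
Evaluation on the generators identifies `H¹(A(Γ), F)` with the functions on the vertices of `Γ`.
Under this identification `f ∪ g = 0` if and only if `f v * g w = f w * g v` on every edge
(`CupProduct.cup_eq_zero_iff_edgePairing`): a primitive of the cocycle `f ∪ g` makes it symmetric on
commuting pairs, and conversely the condition is what is needed to extend `v ↦ (f v, g v, 0)` to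
a homomorphism from `A(Γ)` to the Heisenberg group, whose corner entry gives a primitive. No
computation of `H²(A(Γ), F)` is needed, because pairing-connectedness, valence and the Cheeger
constant only depend on which pairs of vectors pair to zero. So the cup product may be replaced by
the explicit `SimpleGraph.edgePairing` on functions, for which each invariant is that of the graph.

* Connectedness: a decomposition `V₀ ⊕ V₁` with `q(V₀, V₁) = 0` restricts on every edge to
  a decomposition in which one of the summands is zero, and connectedness makes it the same summand
  throughout; the functions supported on a component give the converse.
* The valence is the maximal degree.
* The Cheeger constants agree: the functions supported on a set `A` of vertices form a subspace with
  the constant of `A`, and a subspace `Z` with orthogonal complement `C` yields a set `A` of `dim Z`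
  vertices with `|∂A| ≤ dim V - dim (Z + C)`
  (`SimpleGraph.exists_finrank_sup_orthogonal_add_ncard_vertexBoundary_le`).
-/

/-! ### The Heisenberg group over a field -/

/-- The Heisenberg group of upper unitriangular `3 × 3` matrices over `F`: the triple `(x, y, z)`
stands for the matrix with `x`, `y` above the diagonal and `z` in the corner. -/
@[ext]
structure HeisenbergGroup (F : Type u) where
  x : F
  y : F
  z : F

namespace HeisenbergGroup

variable {F : Type u} [Field F]

instance : Mul (HeisenbergGroup F) := ⟨fun a b => ⟨a.x + b.x, a.y + b.y, a.z + b.z + a.x * b.y⟩⟩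

instance : One (HeisenbergGroup F) := ⟨⟨0, 0, 0⟩⟩

instance : Inv (HeisenbergGroup F) := ⟨fun a => ⟨-a.x, -a.y, -a.z + a.x * a.y⟩⟩

@[simp] lemma mul_x (a b : HeisenbergGroup F) : (a * b).x = a.x + b.x := rfl

@[simp] lemma mul_y (a b : HeisenbergGroup F) : (a * b).y = a.y + b.y := rfl

@[simp] lemma mul_z (a b : HeisenbergGroup F) : (a * b).z = a.z + b.z + a.x * b.y := rfl

@[simp] lemma one_x : (1 : HeisenbergGroup F).x = 0 := rfl

@[simp] lemma one_y : (1 : HeisenbergGroup F).y = 0 := rfl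

@[simp] lemma one_z : (1 : HeisenbergGroup F).z = 0 := rfl

@[simp] lemma inv_x (a : HeisenbergGroup F) : a⁻¹.x = -a.x := rfl

@[simp] lemma inv_y (a : HeisenbergGroup F) : a⁻¹.y = -a.y := rfl

@[simp] lemma inv_z (a : HeisenbergGroup F) : a⁻¹.z = -a.z + a.x * a.y := rfl

instance : Group (HeisenbergGroup F) :=
  Group.ofLeftAxioms
    (fun a b c => by ext <;> simp <;> ring)
    (fun a => by ext <;> simp)
    (fun a => by ext <;> simp)

end HeisenbergGroup

/-! ### Homomorphisms out of a right-angled Artin group -/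

namespace RightAngledArtinGroup

variable {V : Type u} {Γ : SimpleGraph V}

/-- The universal property: a map on the vertices that sends adjacent vertices to commuting elements
extends to the right-angled Artin group. -/
def lift {H : Type*} [Group H] (φ : V → H) (hφ : ∀ v w, Γ.Adj v w → φ v * φ w = φ w * φ v) :
    RightAngledArtinGroup Γ →* H :=
  PresentedGroup.toGroup (f := φ) (by
    rintro r ⟨v, w, hvw, rfl⟩
    simp [hφ v w hvw])

@[simp] lemma lift_of {H : Type*} [Group H] (φ : V → H)
    (hφ : ∀ v w, Γ.Adj v w → φ v * φ w = φ w * φ v) (v : V) :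
    lift φ hφ (PresentedGroup.of v) = φ v :=
  PresentedGroup.toGroup.of _

lemma commute_of (v w : V) (h : Γ.Adj v w) :
    (PresentedGroup.of v * PresentedGroup.of w : RightAngledArtinGroup Γ)
      = PresentedGroup.of w * PresentedGroup.of v := by
  have := PresentedGroup.one_of_mem (rels := {r : FreeGroup V | ∃ v w, Γ.Adj v w ∧
    r = FreeGroup.of v * FreeGroup.of w * (FreeGroup.of v)⁻¹ * (FreeGroup.of w)⁻¹}) ⟨v, w, h, rfl⟩
  simp only [map_mul, map_inv] at this
  rw [mul_inv_eq_one, mul_inv_eq_iff_eq_mul] at this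
  exact this

end RightAngledArtinGroup

/-! ### The cohomology pairing of a right-angled Artin group -/

/-- The pairing on functions on the vertices which records, for each oriented edge `(v, w)`, the
minor `f v * g w - f w * g v`. It is a model of the cup product in degree one on `A(Γ)`. -/
def SimpleGraph.edgePairing {V : Type*} (Γ : SimpleGraph V) (F : Type*) [Field F] :
    (V → F) →ₗ[F] (V → F) →ₗ[F] (Γ.Dart → F) :=
  LinearMap.mk₂ F (fun f g d => f d.fst * g d.snd - f d.snd * g d.fst)
    (fun f f' g => by ext d; simp; ring)
    (fun c f g => by ext d; simp; ring)
    (fun f g g' => by ext d; simp; ring)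
    (fun c f g => by ext d; simp; ring)

lemma SimpleGraph.edgePairing_eq_zero_iff {V : Type*} {Γ : SimpleGraph V} {F : Type*} [Field F]
    {f g : V → F} :
    Γ.edgePairing F f g = 0 ↔ ∀ v w, Γ.Adj v w → f v * g w = f w * g v := by
  rw [funext_iff]
  refine ⟨fun h v w hvw => sub_eq_zero.1 (h ⟨(v, w), hvw⟩), fun h d => ?_⟩
  exact sub_eq_zero.2 (h _ _ d.adj)

namespace CupProduct

variable {F : Type u} [Field F] {V : Type u} {Γ : SimpleGraph V}

/-- The value of a degree one class on a group element. -/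
noncomputable def evalAt {G : Type u} [Group G] (a : H1 F G) (g : G) : F := repr a g

lemma evalAt_mul {G : Type u} [Group G] (a : H1 F G) (g h : G) :
    evalAt a (g * h) = evalAt a g + evalAt a h :=
  groupCohomology.cocycles₁_map_mul_of_isTrivial (repr a) g h

/-- A degree one class as a homomorphism to the additive group of `F`. -/
noncomputable def evalHom {G : Type u} [Group G] (a : H1 F G) : G →* Multiplicative F :=
  MonoidHom.mk' (fun g => Multiplicative.ofAdd (evalAt a g)) (fun g h => evalAt_mul a g h)

lemma repr_injective {G : Type u} [Group G] : Function.Injective (repr (F := F) (G := G)) := by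
  intro a b h
  have h' :=
    (groupCohomology.cocycles₁IsoOfIsTrivial (Rep.trivial F G F)).toLinearEquiv.symm.injective h
  exact (groupCohomology.H1IsoOfIsTrivial (Rep.trivial F G F)).toLinearEquiv.injective h'

lemma cup_eq_zero_iff {G : Type u} [Group G] (a b : H1 F G) :
    cup a b = 0 ↔ ∃ φ : G → F, ∀ g h, evalAt a g * evalAt b h = φ h - φ (g * h) + φ g := by
  change groupCohomology.H2π (Rep.trivial F G F) (cocycle (repr a) (repr b)) = 0 ↔ _
  rw [groupCohomology.H2π_eq_zero_iff]
  constructor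
  · rintro ⟨φ, hφ⟩
    exact ⟨φ, fun g h => (congrFun hφ (g, h)).symm⟩
  · rintro ⟨φ, hφ⟩
    exact ⟨φ, funext fun p => (hφ p.1 p.2).symm⟩

variable (F Γ) in
/-- The values on the generators identify `H¹(A(Γ), F)` with the functions on the vertices. -/
noncomputable def evalGen : H1 F (RightAngledArtinGroup Γ) →ₗ[F] (V → F) where
  toFun a v := evalAt a (PresentedGroup.of v)
  map_add' a b := by
    ext v; simp only [evalAt, map_add]; rfl
  map_smul' c a := by
    ext v; simp only [evalAt, map_smul]; rfl

lemma evalGen_bijective : Function.Bijective (evalGen F Γ) := by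
  constructor
  · intro a b h
    apply repr_injective
    have : evalHom a = evalHom b := PresentedGroup.ext fun v => congrFun h v
    ext g
    exact DFunLike.congr_fun this g
  · intro f
    let φ : RightAngledArtinGroup Γ →* Multiplicative F :=
      RightAngledArtinGroup.lift (fun v => Multiplicative.ofAdd (f v)) (fun v w _ => mul_comm _ _)
    let c : groupCohomology.cocycles₁ (Rep.trivial F (RightAngledArtinGroup Γ) F) :=
      ⟨fun g => (φ g).toAdd, (groupCohomology.mem_cocycles₁_iff _).2 fun g h => by
        rw [map_mul, mul_comm]; rfl⟩
    refine ⟨groupCohomology.H1π _ c, funext fun v => ?_⟩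
    change (repr (groupCohomology.H1π _ c)) (PresentedGroup.of v) = f v
    rw [repr_H1π]
    change (φ (PresentedGroup.of v)).toAdd = f v
    simp [φ]

/-- The cup product of two classes on `A(Γ)` vanishes exactly when their `edgePairing` does.
A primitive of the cup product is symmetric on commuting pairs, which gives the condition on every
edge. Conversely, `v ↦ (f v, g v, 0)` extends to a homomorphism to the Heisenberg group, whose
corner entry is, up to sign, a primitive. -/
lemma cup_eq_zero_iff_edgePairing (a b : H1 F (RightAngledArtinGroup Γ)) :
    cup a b = 0 ↔ Γ.edgePairing F (evalGen F Γ a) (evalGen F Γ b) = 0 := by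
  rw [cup_eq_zero_iff, SimpleGraph.edgePairing_eq_zero_iff]
  constructor
  · rintro ⟨φ, hφ⟩ v w hvw
    have h₁ := hφ (PresentedGroup.of v) (PresentedGroup.of w)
    have h₂ := hφ (PresentedGroup.of w) (PresentedGroup.of v)
    rw [RightAngledArtinGroup.commute_of v w hvw] at h₁
    change evalAt a _ * evalAt b _ = evalAt a _ * evalAt b _
    rw [h₁, h₂]; ring
  · intro h
    let ψ : RightAngledArtinGroup Γ →* HeisenbergGroup F :=
      RightAngledArtinGroup.lift (fun v => ⟨evalGen F Γ a v, evalGen F Γ b v, 0⟩)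
        (fun v w hvw => by
          ext
          · exact add_comm _ _
          · exact add_comm _ _
          · simpa using h v w hvw)
    let px : HeisenbergGroup F →* Multiplicative F :=
      MonoidHom.mk' (fun t => Multiplicative.ofAdd t.x) (fun _ _ => rfl)
    let py : HeisenbergGroup F →* Multiplicative F :=
      MonoidHom.mk' (fun t => Multiplicative.ofAdd t.y) (fun _ _ => rfl)
    have hx : px.comp ψ = evalHom a := PresentedGroup.ext fun v => by
      change Multiplicative.ofAdd (ψ (PresentedGroup.of v)).x = _
      rw [RightAngledArtinGroup.lift_of]; rfl
    have hy : py.comp ψ = evalHom b := PresentedGroup.ext fun v => by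
      change Multiplicative.ofAdd (ψ (PresentedGroup.of v)).y = _
      rw [RightAngledArtinGroup.lift_of]; rfl
    have hx' (g) : (ψ g).x = evalAt a g := DFunLike.congr_fun hx g
    have hy' (g) : (ψ g).y = evalAt b g := DFunLike.congr_fun hy g
    refine ⟨fun g => -(ψ g).z, fun g k => ?_⟩
    change _ = -(ψ k).z - -(ψ (g * k)).z + -(ψ g).z
    rw [map_mul, HeisenbergGroup.mul_z, hx', hy']
    ring

end CupProduct

/-! ### Invariance of the notions under isomorphism of pairings -/

namespace Pairing

variable {F M N W W' : Type*} [Field F] [AddCommGroup M] [Module F M] [AddCommGroup N] [Module F N]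
  [AddCommGroup W] [Module F W] [AddCommGroup W'] [Module F W']
  {q : M →ₗ[F] M →ₗ[F] W} {q' : N →ₗ[F] N →ₗ[F] W'}

lemma IsConnected.of_equiv (e : M ≃ₗ[F] N) (h : ∀ a b, q a b = 0 ↔ q' (e a) (e b) = 0)
    (hq : IsConnected q') : IsConnected q := by
  intro V₀ V₁ hc h₀ h₁
  obtain ⟨_, ⟨a, ha, rfl⟩, _, ⟨b, hb, rfl⟩, hab⟩ := hq (V₀.map e.toLinearMap) (V₁.map e.toLinearMap)
    (hc.map (Submodule.orderIsoMapComap e))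
    (by simpa [Submodule.map_eq_bot_iff] using h₀) (by simpa [Submodule.map_eq_bot_iff] using h₁)
  exact ⟨a, ha, b, hb, fun h' => hab ((h a b).1 h')⟩

lemma IsBasisSet.image (e : M ≃ₗ[F] N) {B : Set M} (hB : IsBasisSet F B) :
    IsBasisSet F (e '' B) := by
  refine ⟨?_, ?_⟩
  · exact (hB.1.map_injOn e.toLinearMap e.injective.injOn).id_image
  · rw [← LinearEquiv.coe_coe, Submodule.span_image, hB.2, Submodule.map_top, LinearEquiv.range]

lemma valence_le_of_equiv (e : M ≃ₗ[F] N) (h : ∀ a b, q a b = 0 ↔ q' (e a) (e b) = 0) :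
    valence q' ≤ valence q := by
  refine le_iInf₂ fun S hS => le_iInf₂ fun B hB => ?_
  refine (iInf₂_le (e '' S) ⟨hS.1.image e, ?_⟩).trans
    ((iInf₂_le (e '' B) (hB.image e)).trans (iSup₂_le ?_))
  · rintro _ ⟨s, hs, rfl⟩
    refine le_trans ?_ (le_iSup₂ (f := fun s _ => {b ∈ B | q s b ≠ 0}.encard) s hs)
    rw [← e.injective.encard_image {b ∈ B | q s b ≠ 0}]
    refine Set.encard_le_encard ?_
    rintro _ ⟨⟨b, hb, rfl⟩, hsb⟩
    exact ⟨b, ⟨hb, fun h' => hsb ((h s b).1 h')⟩, rfl⟩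
  · rw [← LinearEquiv.coe_coe, Submodule.span_image, hS.2, Submodule.map_top, LinearEquiv.range]

lemma map_orthogonal (e : M ≃ₗ[F] N) (h : ∀ a b, q a b = 0 ↔ q' (e a) (e b) = 0)
    (Z : Submodule F M) :
    orthogonal q' (Z.map e.toLinearMap) = (orthogonal q Z).map e.toLinearMap := by
  ext x
  obtain ⟨x, rfl⟩ := e.surjective x
  refine ⟨fun hx => ⟨x, fun z hz => (h x z).2 (hx _ ⟨z, hz, rfl⟩), rfl⟩, ?_⟩
  rintro ⟨y, hy, hyx⟩ _ ⟨z, hz, rfl⟩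
  obtain rfl := e.injective hyx
  exact (h y z).1 (hy z hz)

lemma isoperimetricConst_map (e : M ≃ₗ[F] N) (h : ∀ a b, q a b = 0 ↔ q' (e a) (e b) = 0)
    (Z : Submodule F M) :
    isoperimetricConst q' (Z.map e.toLinearMap) = isoperimetricConst q Z := by
  unfold isoperimetricConst
  rw [map_orthogonal e h, ← Submodule.map_inf _ e.injective, e.finrank_map_eq, e.finrank_map_eq,
    e.finrank_map_eq, e.finrank_eq]

lemma cheegerConst_le_of_equiv (e : M ≃ₗ[F] N) (h : ∀ a b, q a b = 0 ↔ q' (e a) (e b) = 0) :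
    cheegerConst q' ≤ cheegerConst q := by
  refine le_iInf₂ fun Z hZ => ?_
  rw [← isoperimetricConst_map e h]
  refine iInf₂_le (Z.map e.toLinearMap) ⟨?_, ?_⟩
  · simpa [Submodule.map_eq_bot_iff] using hZ.1
  · rw [e.finrank_map_eq, ← e.finrank_eq]
    exact hZ.2

lemma symm_equiv_vanishing (e : M ≃ₗ[F] N) (h : ∀ a b, q a b = 0 ↔ q' (e a) (e b) = 0) (a b : N) :
    q' a b = 0 ↔ q (e.symm a) (e.symm b) = 0 := by
  simp [h]

lemma isConnected_congr (e : M ≃ₗ[F] N) (h : ∀ a b, q a b = 0 ↔ q' (e a) (e b) = 0) :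
    IsConnected q ↔ IsConnected q' :=
  ⟨IsConnected.of_equiv e.symm (symm_equiv_vanishing e h), IsConnected.of_equiv e h⟩

lemma valence_congr (e : M ≃ₗ[F] N) (h : ∀ a b, q a b = 0 ↔ q' (e a) (e b) = 0) :
    valence q = valence q' :=
  (valence_le_of_equiv e.symm (symm_equiv_vanishing e h)).antisymm (valence_le_of_equiv e h)

lemma cheegerConst_congr (e : M ≃ₗ[F] N) (h : ∀ a b, q a b = 0 ↔ q' (e a) (e b) = 0) :
    cheegerConst q = cheegerConst q' :=
  (cheegerConst_le_of_equiv e.symm (symm_equiv_vanishing e h)).antisymm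
    (cheegerConst_le_of_equiv e h)

end Pairing

open Module

/-! ### A dimension count for spaces of functions -/

/-- If a function in `K` is determined by its values outside `T`, then `dim K ≤ |V| - |T|`. -/
lemma Submodule.finrank_add_ncard_le_of_forall_eq_zero {F V : Type*} [Field F] [Finite V]
    (K : Submodule F (V → F)) (T : Set V)
    (h : ∀ x ∈ K, (∀ v ∉ T, x v = 0) → x = 0) : finrank F K + T.ncard ≤ Nat.card V := by
  have := Fintype.ofFinite V
  have hd : K ⊓ Pi.spanSubset F T = ⊥ := by
    rw [Submodule.eq_bot_iff]
    rintro x ⟨hx, hxT⟩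
    exact h x hx (Pi.mem_spanSubset_iff.1 hxT)
  have h₁ := Submodule.finrank_sup_add_finrank_inf_eq K (Pi.spanSubset F T)
  rw [hd, finrank_bot, Pi.dim_spanSubset] at h₁
  have h₂ := Submodule.finrank_le (K ⊔ Pi.spanSubset F T)
  rw [finrank_fintype_fun_eq_card, ← Nat.card_eq_fintype_card] at h₂
  omega

namespace SimpleGraph

variable {V : Type*} {Γ : SimpleGraph V} {F : Type*} [Field F]

/-! ### Connectedness -/

lemma isConnected_edgePairing (hΓ : Γ.Preconnected) : Pairing.IsConnected (Γ.edgePairing F) := by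
  classical
  intro V₀ V₁ hc h₀ h₁
  by_contra! hq
  -- At a vertex with a neighbour, `V₀` or `V₁` vanishes (`excl`), and vanishing of `V₀` spreads along
  -- edges (`prop`), so that on a connected graph one of `V₀`, `V₁` vanishes everywhere.
  have decomp : ∀ x : V → F, ∃ y ∈ V₀, ∃ z ∈ V₁, y + z = x := fun x =>
    Submodule.mem_sup.1 (hc.sup_eq_top ▸ Submodule.mem_top)
  have hq' : ∀ f ∈ V₀, ∀ g ∈ V₁, ∀ v w, Γ.Adj v w → f v * g w = f w * g v := fun f hf g hg =>
    edgePairing_eq_zero_iff.1 (hq f hf g hg)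
  have excl : ∀ v w, Γ.Adj v w → ∀ f ∈ V₀, ∀ g ∈ V₁, f v ≠ 0 → g v = 0 := by
    intro v w hvw f hf g hg hfv
    by_contra hgv
    -- both spaces then restrict to the same line in the functions on the edge
    have key : ∀ x : V → F, f v * x w = f w * x v := by
      intro x
      obtain ⟨y, hy, z, hz, rfl⟩ := decomp x
      have e₁ := hq' f hf z hz v w hvw
      have e₂ := hq' y hy g hg v w hvw
      have e₃ := hq' f hf g hg v w hvw
      have : g v * (f v * y w) = g v * (f w * y v) := by
        linear_combination (-f v) * e₂ + y v * e₃
      have := mul_left_cancel₀ hgv this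
      simp only [Pi.add_apply]
      linear_combination e₁ + this
    have := key (Pi.single w 1)
    simp [hvw.ne] at this
    exact hfv this
  have prop : ∀ v w, Γ.Adj v w → (∀ f ∈ V₀, f v = 0) → ∀ f ∈ V₀, f w = 0 := by
    intro v w hvw hv f hf
    by_contra hfw
    obtain ⟨y, hy, z, hz, hyz⟩ := decomp (Pi.single v 1)
    have hzv : z v = 1 := by
      have := congrFun hyz v
      simpa [hv y hy] using this
    have := hq' f hf z hz v w hvw
    rw [hv f hf, hzv] at this
    simp at this
    exact hfw this.symm
  obtain ⟨f, hf, hf0⟩ := Submodule.exists_mem_ne_zero_of_ne_bot h₀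
  obtain ⟨g, hg, hg0⟩ := Submodule.exists_mem_ne_zero_of_ne_bot h₁
  obtain ⟨v, hv⟩ := Function.ne_iff.1 hf0
  obtain ⟨w, hw⟩ := Function.ne_iff.1 hg0
  have hreach : ∀ a b, Γ.Reachable a b → (∀ f ∈ V₀, f a = 0) → ∀ f ∈ V₀, f b = 0 := by
    rintro a b ⟨p⟩
    induction p with
    | nil => exact id
    | cons h _ ih => exact fun ha => ih (prop _ _ h ha)
  by_cases hvw : v = w
  · subst hvw
    by_cases hN : ∃ u, Γ.Adj v u
    · obtain ⟨u, hu⟩ := hN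
      exact hw (excl v u hu f hf g hg hv)
    · -- a connected graph with an isolated vertex is a point, so `f` and `g` are proportional
      have hall : ∀ u, u = v := by
        intro u
        obtain ⟨p⟩ := hΓ v u
        cases p with
        | nil => rfl
        | cons h _ => exact absurd ⟨_, h⟩ hN
      have hfg : g v • f = f v • g := by
        ext u
        simp [hall u, mul_comm]
      have : g v • f ∈ V₀ ⊓ V₁ := ⟨V₀.smul_mem _ hf, hfg ▸ V₁.smul_mem _ hg⟩
      rw [hc.inf_eq_bot, Submodule.mem_bot, smul_eq_zero] at this
      exact this.elim hw hf0
  · have : ∃ u, Γ.Adj w u := by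
      obtain ⟨p⟩ := hΓ w v
      cases p with
      | nil => exact absurd rfl hvw
      | cons h _ => exact ⟨_, h⟩
    obtain ⟨u, hu⟩ := this
    exact hv (hreach w v (hΓ w v) (fun f' hf' => by
      by_contra hne
      exact hw (excl w u hu f' hf' g hg hne)) f hf)

lemma preconnected_of_isConnected_edgePairing (h : Pairing.IsConnected (Γ.edgePairing F)) :
    Γ.Preconnected := by
  classical
  intro a b
  by_contra hab
  -- The functions supported on the component of `a` and those vanishing on it.
  let V₀ : Submodule F (V → F) :=
    { carrier := {f | ∀ v, ¬ Γ.Reachable a v → f v = 0}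
      zero_mem' := by simp
      add_mem' := fun hf hg v hv => by simp [hf v hv, hg v hv]
      smul_mem' := fun c f hf v hv => by simp [hf v hv] }
  let V₁ : Submodule F (V → F) :=
    { carrier := {f | ∀ v, Γ.Reachable a v → f v = 0}
      zero_mem' := by simp
      add_mem' := fun hf hg v hv => by simp [hf v hv, hg v hv]
      smul_mem' := fun c f hf v hv => by simp [hf v hv] }
  have hc : IsCompl V₀ V₁ := by
    refine IsCompl.of_eq ?_ ?_
    · rw [Submodule.eq_bot_iff]
      rintro f ⟨hf₀, hf₁⟩
      ext v
      by_cases hv : Γ.Reachable a v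
      exacts [hf₁ v hv, hf₀ v hv]
    · rw [Submodule.eq_top_iff']
      intro f
      refine Submodule.mem_sup.2 ⟨fun v => if Γ.Reachable a v then f v else 0,
        fun v hv => if_neg hv, fun v => if Γ.Reachable a v then 0 else f v,
        fun v hv => if_pos hv, ?_⟩
      ext v
      by_cases hv : Γ.Reachable a v <;> simp [hv]
  have h₀ : V₀ ≠ ⊥ := (Submodule.ne_bot_iff _).2 ⟨Pi.single a 1, fun v hv => by
    rw [Pi.single_eq_of_ne]; rintro rfl; exact hv (Reachable.refl _), by simp⟩
  have h₁ : V₁ ≠ ⊥ := (Submodule.ne_bot_iff _).2 ⟨Pi.single b 1, fun v hv => by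
    rw [Pi.single_eq_of_ne]; rintro rfl; exact hab hv, by simp⟩
  obtain ⟨f, hf, g, hg, hfg⟩ := h V₀ V₁ hc h₀ h₁
  refine hfg (edgePairing_eq_zero_iff.2 fun v w hvw => ?_)
  by_cases hv : Γ.Reachable a v
  · rw [hg v hv, hg w (hv.trans hvw.reachable)]; simp
  · rw [hf v hv, hf w fun hw => hv (hw.trans hvw.symm.reachable)]; simp

/-! ### Valence -/

variable [Finite V]

/-- For spanning `S` and a basis `B`, some `s ∈ S` has `s v ≠ 0`. A function orthogonal to `s` is then
determined by its values at the vertices that are not neighbours of `v`, so at least `deg v` elements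
of `B` are not orthogonal to `s`. -/
lemma ncard_neighborSet_le_valence (v : V) :
    ((Γ.neighborSet v).ncard : ℕ∞) ≤ Pairing.valence (Γ.edgePairing F) := by
  classical
  have := Fintype.ofFinite V
  refine le_iInf₂ fun S hS => le_iInf₂ fun B hB => ?_
  obtain ⟨s, hs, hsv⟩ : ∃ s ∈ S, s v ≠ 0 := by
    by_contra! hS0
    have : Submodule.span F S ≤ LinearMap.ker (LinearMap.proj v : (V → F) →ₗ[F] F) :=
      Submodule.span_le.2 hS0
    rw [hS.2] at this
    have h1 : (Pi.single v 1 : V → F) ∈ LinearMap.ker (LinearMap.proj v : (V → F) →ₗ[F] F) :=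
      this Submodule.mem_top
    simp at h1
  refine le_trans ?_ (le_iSup₂ (f := fun s _ => {b ∈ B | Γ.edgePairing F s b ≠ 0}.encard) s hs)
  have hK := Submodule.finrank_add_ncard_le_of_forall_eq_zero
    (LinearMap.ker (Γ.edgePairing F s)) (Γ.neighborSet v) (by
      intro b hb hb0
      have hbv : b v = 0 := hb0 v (by simp)
      ext w
      by_cases hw : Γ.Adj v w
      · have := edgePairing_eq_zero_iff.1 hb v w hw
        rw [hbv, mul_zero] at this
        exact (mul_eq_zero.1 this).resolve_left hsv
      · exact hb0 w hw)
  have hBfin : B.Finite := hB.1.setFinite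
  have hBcard : B.ncard = Nat.card V := by
    have := hBfin.fintype
    rw [Set.ncard_eq_toFinset_card', ← finrank_span_set_eq_card hB.1, hB.2, finrank_top,
      finrank_fintype_fun_eq_card, Nat.card_eq_fintype_card]
  have hB' : {b ∈ B | Γ.edgePairing F s b = 0}.ncard
      ≤ finrank F (LinearMap.ker (Γ.edgePairing F s)) := by
    have hfin : {b ∈ B | Γ.edgePairing F s b = 0}.Finite := hBfin.subset (Set.sep_subset _ _)
    have := hfin.fintype
    rw [Set.ncard_eq_toFinset_card', ← finrank_span_set_eq_card (hB.1.mono (Set.sep_subset _ _))]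
    exact Submodule.finrank_mono (Submodule.span_le.2 fun b hb => hb.2)
  have hfin : {b ∈ B | Γ.edgePairing F s b ≠ 0}.Finite := hBfin.subset (Set.sep_subset _ _)
  have hsplit : {b ∈ B | Γ.edgePairing F s b = 0}.ncard
      + {b ∈ B | Γ.edgePairing F s b ≠ 0}.ncard = B.ncard := by
    rw [← Set.ncard_union_eq _ (hBfin.subset (Set.sep_subset _ _)) hfin]
    · congr 1
      ext b
      simp only [Set.mem_union, Set.mem_ofPred_eq]
      tauto
    · rw [Set.disjoint_left]
      exact fun b hb hb' => hb'.2 hb.2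
  rw [← hfin.cast_ncard_eq]
  exact Nat.cast_le.2 (by omega)

/-- The standard basis, used both as spanning set and as basis, realises the degrees. -/
lemma valence_edgePairing_le {d : ℕ} (hd : ∀ v, (Γ.neighborSet v).ncard ≤ d) :
    Pairing.valence (Γ.edgePairing F) ≤ d := by
  classical
  have := Fintype.ofFinite V
  let δ : V → V → F := fun v => Pi.single v 1
  have hδ : δ = Pi.basisFun F V := by ext v; simp [δ]
  have hspan : Submodule.span F (Set.range δ) = ⊤ := hδ ▸ (Pi.basisFun F V).span_eq
  have hB : Pairing.IsBasisSet F (Set.range δ) :=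
    ⟨hδ ▸ (Pi.basisFun F V).linearIndependent.linearIndepOn_id, hspan⟩
  -- `0` is added to the spanning set so that it is nonempty for the empty graph as well.
  refine (iInf₂_le (insert 0 (Set.range δ)) ⟨⟨0, by simp⟩, by simpa using hspan⟩).trans
    ((iInf₂_le (Set.range δ) hB).trans (iSup₂_le ?_))
  rintro s (rfl | ⟨v, rfl⟩)
  · simp
  · have hsub : {b ∈ Set.range δ | Γ.edgePairing F (δ v) b ≠ 0} ⊆ δ '' Γ.neighborSet v := by
      rintro _ ⟨⟨w, rfl⟩, hw⟩
      refine ⟨w, ?_, rfl⟩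
      by_contra hvw
      have aux : ∀ x y, Γ.Adj x y → δ v x * δ w y = 0 := by
        intro x y hxy
        by_cases hx : x = v
        · have hy : y ≠ w := by
            rintro rfl
            exact hvw (hx ▸ hxy)
          simp [δ, hy]
        · simp [δ, hx]
      exact hw (edgePairing_eq_zero_iff.2 fun x y hxy => by rw [aux x y hxy, aux y x hxy.symm])
    refine (Set.encard_le_encard hsub).trans ((Set.encard_image_le _ _).trans ?_)
    rw [← (Set.toFinite (Γ.neighborSet v)).cast_ncard_eq]
    exact_mod_cast hd v

end SimpleGraph

namespace SimpleGraph

variable {V : Type*} {Γ : SimpleGraph V} {F : Type*} [Field F] [Finite V]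

/-! ### The Cheeger constant -/

lemma orthogonal_spanSubset (A : Set V) :
    Pairing.orthogonal (Γ.edgePairing F) (Pi.spanSubset F A)
      = Pi.spanSubset F {v | ¬ ∃ a ∈ A, Γ.Adj a v} := by
  classical
  ext f
  rw [Pi.mem_spanSubset_iff]
  constructor
  · rintro hf v hv
    obtain ⟨a, ha, hav⟩ := not_not.1 hv
    have h := edgePairing_eq_zero_iff.1 (hf (Pi.single a 1) (Pi.mem_spanSubset_iff.2 fun i hi => by
      rw [Pi.single_eq_of_ne]; rintro rfl; exact hi ha)) v a hav.symm
    simpa [hav.ne'] using h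
  · intro hf z hz
    rw [Pi.mem_spanSubset_iff] at hz
    have aux : ∀ v w, Γ.Adj v w → f v * z w = 0 := by
      intro v w hvw
      by_cases hw : w ∈ A
      · rw [hf v (not_not.2 ⟨w, hw, hvw.symm⟩), zero_mul]
      · rw [hz w hw, mul_zero]
    exact edgePairing_eq_zero_iff.2 fun v w hvw => by rw [aux v w hvw, aux w v hvw.symm]

/-- The constant `c_Z` of the space `Z` of functions supported on `A` is that of `A`: if `M` is the
set of vertices with no neighbour in `A`, both numerators count the complement of `M ∪ A`. -/
lemma isoperimetricConst_spanSubset (A : Set V) :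
    Pairing.isoperimetricConst (Γ.edgePairing F) (Pi.spanSubset F A) = Γ.isoperimetricConst A := by
  have := Fintype.ofFinite V
  set M : Set V := {v | ¬ ∃ a ∈ A, Γ.Adj a v} with hM
  have hinf : (Pi.spanSubset F M ⊓ Pi.spanSubset F A : Submodule F (V → F))
      = Pi.spanSubset F (M ∩ A) := by
    ext f
    simp only [Submodule.mem_inf, Pi.mem_spanSubset_iff, Set.mem_inter_iff, not_and_or]
    exact ⟨fun h i hi => hi.elim (h.1 i) (h.2 i), fun h => ⟨fun i hi => h i (.inl hi),
      fun i hi => h i (.inr hi)⟩⟩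
  have hbd : Γ.vertexBoundary A = (M ∪ A)ᶜ := by
    ext v
    simp [vertexBoundary, hM, and_comm]
  unfold Pairing.isoperimetricConst isoperimetricConst
  rw [orthogonal_spanSubset, ← hM, hinf, Pi.dim_spanSubset, Pi.dim_spanSubset, Pi.dim_spanSubset,
    finrank_fintype_fun_eq_card, ← Nat.card_eq_fintype_card, hbd]
  congr 1
  have h₁ := Set.ncard_union_add_ncard_inter M A
  have h₂ := Set.ncard_add_ncard_compl (M ∪ A)
  rw [← h₂]
  have h₁' : ((M ∪ A).ncard : ℝ) + (M ∩ A).ncard = M.ncard + A.ncard := by exact_mod_cast h₁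
  push_cast
  linarith

/-- Every subspace `Z`, with orthogonal complement `C`, is matched by a set of `dim Z` vertices whose
boundary has at most `dim V - dim (Z + C)` elements. For `A` one takes coordinates that restrict to
a basis of the dual of `Z`, preferring those that vanish on `C`. Then each coordinate in the
boundary of `A` agrees on `Z + C` with a linear combination of the coordinates in `A`. -/
lemma exists_finrank_sup_orthogonal_add_ncard_vertexBoundary_le (Z : Submodule F (V → F)) :
    ∃ A : Set V, A.ncard = finrank F Z ∧
      finrank F (Z ⊔ Pairing.orthogonal (Γ.edgePairing F) Z : Submodule F (V → F))
        + (Γ.vertexBoundary A).ncard ≤ Nat.card V := by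
  classical
  have := Fintype.ofFinite V
  set C := Pairing.orthogonal (Γ.edgePairing F) Z
  have hZC : ∀ f ∈ C, ∀ z ∈ Z, ∀ v w, Γ.Adj v w → f v * z w = f w * z v := fun f hf z hz =>
    edgePairing_eq_zero_iff.1 (hf z hz)
  let ρ : V → Dual F Z := fun v => (LinearMap.proj v).comp Z.subtype
  have hρ : ∀ v (z : Z), ρ v z = z.1 v := fun _ _ => rfl
  -- `A` extends a maximal independent subset `A₀` of the coordinates `D` that vanish on `C`.
  let D : Set V := {v | ∀ f ∈ C, f v = 0}
  obtain ⟨A₀, hA₀D, -, hDA₀, hA₀⟩ :=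
    exists_linearIndepOn_extension (linearIndepOn_empty F ρ) (Set.empty_subset D)
  obtain ⟨A, -, hA₀A, hVA, hA⟩ := exists_linearIndepOn_extension hA₀ (Set.subset_univ A₀)
  have hspan : Submodule.span F (ρ '' A) = ⊤ := by
    rw [eq_top_iff]
    intro φ _
    obtain ⟨ψ, rfl⟩ := Subspace.dualRestrict_surjective (W := Z) φ
    have hψ : Z.dualRestrict ψ = ∑ v, ψ (Pi.single v 1) • ρ v := by
      ext z
      rw [Submodule.dualRestrict_apply, LinearMap.pi_apply_eq_sum_univ ψ z.1]
      simp only [LinearMap.sum_apply, LinearMap.smul_apply, hρ, smul_eq_mul]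
      refine Finset.sum_congr rfl fun v _ => ?_
      rw [mul_comm]
      congr 2
      ext j
      simp [Pi.single_apply, eq_comm]
    rw [hψ]
    exact Submodule.sum_mem _ fun v _ => Submodule.smul_mem _ _ (hVA ⟨v, trivial, rfl⟩)
  refine ⟨A, ?_, ?_⟩
  · rw [← Subspace.dual_finrank_eq (K := F) (V := Z), ← finrank_top F (Dual F Z), ← hspan,
      finrank_span_set_eq_card hA.id_image, ← Set.ncard_eq_toFinset_card',
      hA.injOn.ncard_image]
  · refine Submodule.finrank_add_ncard_le_of_forall_eq_zero _ _ fun x hx hx0 => ?_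
    have hxA : ∀ a ∈ A, x a = 0 := fun a ha => hx0 a fun h => h.1 ha
    ext w
    by_cases hw : w ∈ Γ.vertexBoundary A
    swap
    · exact hx0 w hw
    obtain ⟨hwA, a, ha, haw⟩ := hw
    obtain ⟨z, hz, f, hf, rfl⟩ := Submodule.mem_sup.1 hx
    simp only [Pi.add_apply, Pi.zero_apply] at hxA ⊢
    by_cases hwD : w ∈ D
    · have hz0 : ∀ b ∈ A₀, z b = 0 := fun b hb => by
        have := hxA b (hA₀A hb)
        rwa [hA₀D hb f hf, add_zero] at this
      -- `ρ w` is a combination of the `ρ b`, `b ∈ A₀`, all of which vanish at `z`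
      have hle : Submodule.span F (ρ '' A₀) ≤ LinearMap.ker (Dual.eval F Z ⟨z, hz⟩) := by
        rw [Submodule.span_le]
        rintro _ ⟨b, hb, rfl⟩
        exact hz0 b hb
      have hzw : z w = 0 := hle (hDA₀ ⟨w, hwD, rfl⟩)
      rw [hzw, hwD f hf, add_zero]
    · have : ∃ g ∈ C, g w ≠ 0 := by
        by_contra! h
        exact hwD h
      obtain ⟨g, hg, hgw⟩ := this
      -- on `Z` and on `C`, the coordinate `w` is `g w / g a` times the coordinate `a`
      have hgz : ∀ y ∈ Z, g w * y a = g a * y w := fun y hy => (hZC g hg y hy a w haw).symm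
      obtain ⟨y, hy, hya⟩ : ∃ y ∈ Z, y a ≠ 0 := by
        by_contra! h
        exact hA.ne_zero ha (LinearMap.ext fun y => h y.1 y.2)
      have hga : g a ≠ 0 := by
        intro h
        have := hgz y hy
        rw [h, zero_mul] at this
        exact (mul_ne_zero hgw hya) this
      have hfw : g w * f a = g a * f w := by
        have e₁ := hgz y hy
        have e₂ := hZC f hf y hy a w haw
        refine mul_left_cancel₀ hya ?_
        linear_combination f a * e₁ + g a * e₂
      have hzw := hgz z hz
      have hxa := hxA a ha
      refine (mul_eq_zero.1 (?_ : g a * (z w + f w) = 0)).resolve_left hga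
      linear_combination g w * hxa - hzw - hfw

lemma cheegerConst_edgePairing : Pairing.cheegerConst (Γ.edgePairing F) = Γ.cheegerConst := by
  have := Fintype.ofFinite V
  have hdim : finrank F (V → F) = Nat.card V := by
    rw [finrank_fintype_fun_eq_card, Nat.card_eq_fintype_card]
  refine le_antisymm (le_iInf₂ fun A hA => ?_) (le_iInf₂ fun Z hZ => ?_)
  · rw [← isoperimetricConst_spanSubset (F := F)]
    refine iInf₂_le (Pi.spanSubset F A) ⟨?_, ?_⟩
    · intro h
      have := Pi.dim_spanSubset (R := F) (s := A)
      rw [h, finrank_bot] at this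
      exact hA.1.ne_empty ((Set.ncard_eq_zero (Set.toFinite A)).1 this.symm)
    · rw [Pi.dim_spanSubset, hdim]
      exact hA.2
  · obtain ⟨A, hAc, hA⟩ :=
      exists_finrank_sup_orthogonal_add_ncard_vertexBoundary_le (Γ := Γ) Z
    have hpos : 0 < finrank F Z := by
      rw [Nat.pos_iff_ne_zero]
      exact fun h => hZ.1 (Submodule.finrank_eq_zero.1 h)
    have hA₀ : A.Nonempty := by
      rw [← Set.ncard_pos (Set.toFinite A), hAc]
      exact hpos
    have hA₁ : 2 * A.ncard ≤ Nat.card V := by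
      rw [hAc, ← hdim]
      exact hZ.2
    refine (iInf₂_le A ⟨hA₀, hA₁⟩).trans (EReal.coe_le_coe_iff.2 ?_)
    · unfold isoperimetricConst Pairing.isoperimetricConst
      rw [hAc]
      refine div_le_div_of_nonneg_right ?_ (Nat.cast_nonneg _)
      have h₁ := Submodule.finrank_sup_add_finrank_inf_eq Z
        (Pairing.orthogonal (Γ.edgePairing F) Z)
      rw [inf_comm] at h₁
      have h₁' : (finrank F (Z ⊔ Pairing.orthogonal (Γ.edgePairing F) Z : Submodule F (V → F)) : ℝ)
          + finrank F (Pairing.orthogonal (Γ.edgePairing F) Z ⊓ Z : Submodule F (V → F))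
          = finrank F Z + finrank F (Pairing.orthogonal (Γ.edgePairing F) Z) := by
        exact_mod_cast h₁
      have hA' : (finrank F (Z ⊔ Pairing.orthogonal (Γ.edgePairing F) Z : Submodule F (V → F)) : ℝ)
          + (Γ.vertexBoundary A).ncard ≤ Nat.card V := by
        exact_mod_cast hA
      rw [hdim]
      linarith

end SimpleGraph

theorem theorem3 (F : Type u) [Field F] (V : ℕ → Type u) [∀ i, Finite (V i)]
    (Γ : ∀ i, SimpleGraph (V i)) :
    (IsGraphExpanderFamily Γ ↔
      Pairing.IsExpanderFamily (fun i => (Γ i).cohomologyPairing F)) ∧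
    ∀ i, Pairing.cheegerConst ((Γ i).cohomologyPairing F) = (Γ i).cheegerConst := by
  let e i := LinearEquiv.ofBijective (CupProduct.evalGen F (Γ i)) CupProduct.evalGen_bijective
  have he : ∀ i a b, (Γ i).cohomologyPairing F a b = 0 ↔
      (Γ i).edgePairing F (e i a) (e i b) = 0 := fun i =>
    CupProduct.cup_eq_zero_iff_edgePairing
  have hcheeger : ∀ i, Pairing.cheegerConst ((Γ i).cohomologyPairing F) = (Γ i).cheegerConst :=
    fun i => (Pairing.cheegerConst_congr (e i) (he i)).trans SimpleGraph.cheegerConst_edgePairing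
  have hconn : ∀ i, Pairing.IsConnected ((Γ i).cohomologyPairing F) ↔ (Γ i).Preconnected :=
    fun i => (Pairing.isConnected_congr (e i) (he i)).trans
      ⟨SimpleGraph.preconnected_of_isConnected_edgePairing, SimpleGraph.isConnected_edgePairing⟩
  have hval : ∀ i (d : ℕ), Pairing.valence ((Γ i).cohomologyPairing F) ≤ d ↔
      ∀ v, ((Γ i).neighborSet v).ncard ≤ d := by
    intro i d
    rw [Pairing.valence_congr (e i) (he i)]
    exact ⟨fun h v => by exact_mod_cast (SimpleGraph.ncard_neighborSet_le_valence v).trans h,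
      SimpleGraph.valence_edgePairing_le⟩
  have hdim : ∀ i, Module.finrank F (CupProduct.H1 F (RightAngledArtinGroup (Γ i)))
      = Nat.card (V i) := by
    intro i
    have := Fintype.ofFinite (V i)
    rw [(e i).finrank_eq, Module.finrank_fintype_fun_eq_card, Nat.card_eq_fintype_card]
  refine ⟨⟨fun h => ⟨fun i => (hconn i).2 (h.connected i), ?_, ?_, ?_⟩,
    fun h => ⟨fun i => (hconn i).1 (h.connected i), ?_, ?_, ?_⟩⟩, hcheeger⟩
  · obtain ⟨d, hd⟩ := h.degree_bounded
    exact ⟨d, fun i => (hval i d).2 (hd i)⟩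
  · simpa only [hdim] using h.card_tendsto
  · simpa only [hcheeger] using h.cheeger_bounded
  · obtain ⟨d, hd⟩ := h.valence_bounded
    exact ⟨d, fun i => (hval i d).1 (hd i)⟩
  · simpa only [hdim] using h.dim_tendsto
  · simpa only [hcheeger] using h.cheeger_bounded
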